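/- Let $(\mathcal U,\delta)$ be an $\aleph_1$-saturated differentially closed field of characteristic $0$ (saturation is with respect to first-order formulae in the language of differential rings), and let $K\subset\mathcal U$ be a countable differential subfield which is algebraically closed. For $S\subset\mathcal U$, write $K\langle S\rangle$ for the differential subfield of $\mathcal U$ generated by $K\cup S$. Let $Q,R\in K\{T\}$ be differential polynomials in one variable with $R\neq 0$ and $\mathrm{ord}(R)<\mathrm{ord}(Q)=n$, where $n\ge 1$, and suppose that $Q$ is irreducible as a multivariate polynomial over $K$. A \emph{solution} of the equation $Q(T)/R(T)=0$ is an element $a\in\mathcal U$ with $Q(a)=0\neq R(a)$; a solution is \emph{generic} if it is not algebraic over $K$. Suppose that the equation has Property D$_2$ over $K$: for any two distinct generic solutions $a_1\neq a_2$, the family \[a_1,\delta(a_1),\ldots,\delta^{n-1}(a_1),\,a_2,\delta(a_2),\ldots,\delta^{n-1}(a_2)\] is algebraically independent over $K$. (1) Any two distinct generic solutions $a\neq a_1$ form a Morley sequence of length $2$ of the generic type. That is, for every generic solution $c$: the type of $c$ over $K$ is stationary (the extension $K\subset K\langle c\rangle$ is regular); both $a$ and $a_1$ have the same type over $K$ as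 $c$ (the same differential polynomials over $K$ vanish at $a$, at $a_1$ and at $c$); and $K\langle a_1\rangle$ and $K\langle a\rangle$ are algebraically independent over $K$ (every finite tuple of $K\langle a_1\rangle$ which is algebraically dependent over $K\langle a\rangle$ is algebraically dependent over $K$). (2) Let $a$ be a generic solution and let $\bar b$ be a finite tuple in $\mathcal U$, all of whose entries are algebraic over $K\langle a\rangle$. Then either all entries of $\bar b$ lie in $K$, or $a\in K\langle\bar b\rangle$. -/

import Mathlib

open scoped Differential

/-! ### Differential polynomials in one differential variable -/

/-- The order of a differential polynomial `P ∈ R{T} = R[T₀, T₁, …]`: the largest `n` such that the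
variable `T₍ₙ₎` occurs in `P`, and `⊥` (that is, `-∞`) if `P` is constant. -/
noncomputable def diffOrder {R : Type*} [CommRing R] (P : MvPolynomial ℕ R) : WithBot ℕ :=
  P.vars.max

/-- The value `P(a, δ(a), δ²(a), …)` of a differential polynomial `P` with coefficients in `k`. -/
noncomputable def diffEval {k U : Type*} [CommRing k] [CommRing U] [Differential U] [Algebra k U]
    (a : U) (P : MvPolynomial ℕ k) : U :=
  MvPolynomial.aeval (fun i : ℕ => (fun x : U => x′)^[i] a) P

/-- A differential field `U` is differentially closed if for all non-zero differential polynomials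
`P`, `Q` in one variable with `ord Q < ord P` there is an `a` in `U` with `P(a) = 0 ≠ Q(a)`. -/
def IsDifferentiallyClosed (U : Type*) [Field U] [Differential U] : Prop :=
  ∀ P Q : MvPolynomial ℕ U, P ≠ 0 → Q ≠ 0 → diffOrder Q < diffOrder P →
    ∃ a : U, diffEval a P = 0 ∧ diffEval a Q ≠ 0

/-! ### The first-order language of differential rings and saturation -/

/-- The function symbols `0, 1, +, -, ·, δ` of the language of differential rings. -/
inductive DiffRingFunc : ℕ → Type
  | zero : DiffRingFunc 0
  | one : DiffRingFunc 0
  | add : DiffRingFunc 2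
  | neg : DiffRingFunc 1
  | mul : DiffRingFunc 2
  | delta : DiffRingFunc 1

/-- The first-order language of differential rings (no relation symbols besides equality). -/
abbrev diffRingLanguage : FirstOrder.Language where
  Functions := DiffRingFunc
  Relations := fun _ => Empty

/-- The interpretation of the function symbols of the language of differential rings. -/
def DiffRingFunc.interpret {U : Type*} [CommRing U] [Differential U] :
    {n : ℕ} → DiffRingFunc n → (Fin n → U) → U
  | _, .zero, _ => 0
  | _, .one, _ => 1
  | _, .add, x => x 0 + x 1
  | _, .neg, x => -x 0
  | _, .mul, x => x 0 * x 1
  | _, .delta, x => (x 0)′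

/-- Every differential ring is a structure for the language of differential rings. -/
instance diffRingStructure (U : Type*) [CommRing U] [Differential U] :
    diffRingLanguage.Structure U where
  funMap := fun f x => DiffRingFunc.interpret f x
  RelMap := fun r _ => r.elim

/-- A subfield is a differential subfield if it is closed under the derivation. -/
def IsDifferentialSubfield {U : Type*} [Field U] [Differential U] (k : Subfield U) : Prop :=
  ∀ x ∈ k, x′ ∈ k

/-- `U` is `ℵ₁`-saturated: for every countable differential subfield `k`, every collection `S` of
subsets of `Uⁿ` that are definable by first-order formulae with parameters in `k` and that is
finitely consistent (any finitely many members of `S` have a common point) is realized (all members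
of `S` have a common point). -/
def IsAlephOneSaturated (U : Type*) [Field U] [Differential U] : Prop :=
  ∀ k : Subfield U, IsDifferentialSubfield k → Countable k →
    ∀ (n : ℕ) (S : Set (Set (Fin n → U))),
      (∀ X ∈ S, (k : Set U).Definable diffRingLanguage X) →
      (∀ F : Set (Set (Fin n → U)), F ⊆ S → F.Finite → (⋂₀ F).Nonempty) →
      (⋂₀ S).Nonempty

/-! ### Generated differential subfields, types, independence, Morley sequences -/

section Types

variable {U : Type*} [Field U] [Differential U] (K : Subfield U)

/-- The differential subfield `K⟨S⟩` generated by `S` over `K`: the smallest subfield containing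
`K` and `S` which is closed under the derivation. -/
def diffAdjoin (S : Set U) : IntermediateField K U :=
  sInf {L : IntermediateField K U | (∀ x ∈ L, x′ ∈ L) ∧ S ⊆ L}

/-- The vanishing ideal `I(a/K)` of a finite tuple `a`: all differential polynomials over `K`, in
as many differential variables as `a` has entries, that vanish at `a`. The variable `(j, i)` is the
`i`-th derivative of the `j`-th differential variable. -/
noncomputable def vanishingIdeal {r : ℕ} (a : Fin r → U) : Ideal (MvPolynomial (Fin r × ℕ) K) :=
  RingHom.ker (MvPolynomial.aeval (R := K)
    (fun p : Fin r × ℕ => (fun x : U => x′)^[p.2] (a p.1)))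

/-- Two tuples have the same type over `K` if they have the same vanishing ideal over `K`. -/
def SameType {r : ℕ} (a b : Fin r → U) : Prop :=
  vanishingIdeal K a = vanishingIdeal K b

/-- The type of the tuple `a` over `K` is stationary if the field extension `K ⊆ K⟨a⟩` is regular:
`K⟨a⟩` and the algebraic closure of `K` in `U` are linearly disjoint over `K`. -/
def IsStationaryType {r : ℕ} (a : Fin r → U) : Prop :=
  (diffAdjoin K (Set.range a)).LinearDisjoint (algebraicClosure K U)

variable {K} in
/-- Subfields `A` and `B` containing `K` are independent over `K` if every finite tuple of `A` which
is algebraically dependent over `B` is already algebraically dependent over `K`. -/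
def AlgIndependentFields (A B : IntermediateField K U) : Prop :=
  ∀ (r : ℕ) (x : Fin r → U), (∀ i, x i ∈ A) →
    ¬ AlgebraicIndependent B x → ¬ AlgebraicIndependent K x

/-- `s = (s₀, …, s₍ₘ₋₁₎)` is a Morley sequence of the (stationary) type of the tuple `a` over `K`:
every `sᵢ` realizes the type of `a` over `K`, and `K⟨sᵢ⟩` is independent from
`K⟨s₀, …, s₍ᵢ₋₁₎⟩` over `K` for every `i ≥ 1`. -/
def IsMorleySequence {r m : ℕ} (a : Fin r → U) (s : Fin m → Fin r → U) : Prop :=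
  IsStationaryType K a ∧ (∀ i, SameType K (s i) a) ∧
    ∀ i : Fin m, 1 ≤ (i : ℕ) →
      AlgIndependentFields (diffAdjoin K (Set.range (s i)))
        (diffAdjoin K {x : U | ∃ j : Fin m, j < i ∧ x ∈ Set.range (s j)})

end Types

/-! ### Differential algebraic equations and Property `Dₘ` -/

/-- A differential algebraic equation `Q(T)/R(T) = 0` over `k`, where `R ≠ 0` and
`ord R < ord Q`. -/
structure DiffAlgEquation (k : Type*) [CommRing k] where
  /-- the numerator `Q` -/
  num : MvPolynomial ℕ k
  /-- the denominator `R` -/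
  den : MvPolynomial ℕ k
  den_ne_zero : den ≠ 0
  order_den_lt : diffOrder den < diffOrder num

namespace DiffAlgEquation

/-- The order of the equation is the order of its numerator (which is never `⊥`, see
`coe_order`). -/
noncomputable def order {k : Type*} [CommRing k] (E : DiffAlgEquation k) : ℕ :=
  (diffOrder E.num).unbotD 0

theorem coe_order {k : Type*} [CommRing k] (E : DiffAlgEquation k) :
    ((E.order : ℕ) : WithBot ℕ) = diffOrder E.num := by
  have h : diffOrder E.num ≠ ⊥ := ne_bot_of_gt E.order_den_lt
  obtain ⟨n, hn⟩ := WithBot.ne_bot_iff_exists.mp h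
  rw [order, ← hn, WithBot.unbotD_coe]
  rfl

/-- The equation is irreducible if its numerator is irreducible as a multivariate polynomial. -/
def IsIrreducible {k : Type*} [CommRing k] (E : DiffAlgEquation k) : Prop :=
  Irreducible E.num

section Solutions

variable {U : Type*} [Field U] [Differential U] {K : Subfield U} (E : DiffAlgEquation K)

/-- A solution is an element `a` of `U` with `Q(a) = 0 ≠ R(a)`. -/
def IsSolution (a : U) : Prop :=
  diffEval a E.num = 0 ∧ diffEval a E.den ≠ 0

/-- A generic solution (over `K`) is a solution which is not algebraic over `K`. -/
def IsGenericSolution (a : U) : Prop :=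
  E.IsSolution a ∧ ¬ IsAlgebraic K a

/-- Property `Dₘ`: for any `m` pairwise distinct solutions `a₁, …, aₘ`, none of them algebraic over
`K`, the family of all `δⁱ(aⱼ)`, `i < n`, is algebraically independent over `K`, where `n` is the
order of the equation. -/
def PropertyD (m : ℕ) : Prop :=
  ∀ a : Fin m → U, Function.Injective a → (∀ j, E.IsSolution (a j) ∧ ¬ IsAlgebraic K (a j)) →
    AlgebraicIndependent K
      (fun p : Fin m × Fin E.order => (fun x : U => x′)^[(p.2 : ℕ)] (a p.1))

end Solutions

end DiffAlgEquation

/-! Write the numerator as a polynomial `P` in its leading variable `T_n` over `K[T_0, …, T_{n-1}]`.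
Differentiating `P(x) = 0` expresses `δ^{n+1}(x)` through the lower derivatives, with the separant
`∂P/∂T_n` as denominator. So on zeros of `P` with nonzero separant, every differential polynomial
becomes, up to a power of the separant, a polynomial of order at most `n`. If `a, …, δ^{n-1}(a)` are
independent, such polynomials vanish at `a` exactly when `P` divides them.

Part (1): Property D₂ makes the first `n` derivatives of `a` and `a₁` jointly independent. Hence
both have the type determined by `P`, and all higher derivatives are algebraic over the first `n`,
so a rank count (`Matroid.Indep.union_of_subset_closure`) gives independence of the generated
fields. Stationarity is clear since `K` is algebraically closed.

Part (2): let some entry `b` lie outside `K` and suppose `a ∉ k = K⟨b̄⟩`. Then `a` has a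
specialization `x ≠ a` over `k` (`exists_ne_specialization`), which can be chosen to be a generic
solution with `b` still algebraic over `K⟨x⟩`. As `K⟨a⟩` and `K⟨x⟩` are independent, `b` is
algebraic over `K`, hence in `K`, a contradiction. -/

/-! ### Elimination of the leading variable -/

open Polynomial in
-- By Gauss's lemma `P` stays irreducible over the fraction field and does not divide `G` there.
-- Clearing denominators in a Bézout identity gives `H`, which plays the role of a resultant.
theorem Polynomial.exists_C_eq_mul_add_mul_of_irreducible {A : Type*} [CommRing A] [IsDomain A]
    [NormalizedGCDMonoid A] {P G : A[X]} (hP : Irreducible P) (hdeg : P.natDegree ≠ 0)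
    (hG : ¬ P ∣ G) : ∃ H : A, H ≠ 0 ∧ ∃ u v : A[X], C H = u * P + v * G := by
  let F := FractionRing A
  have hprim : P.IsPrimitive := hP.isPrimitive hdeg
  have hPF : Irreducible (P.map (algebraMap A F)) :=
    (hprim.irreducible_iff_irreducible_map_fraction_map (K := F)).1 hP
  have hGF : ¬ P.map (algebraMap A F) ∣ G.map (algebraMap A F) := fun h =>
    hG (hprim.dvd_of_fraction_map_dvd_fraction_map h)
  obtain ⟨u, v, huv⟩ := (hPF.coprime_iff_not_dvd.2 hGF)
  obtain ⟨s, hs0, hs⟩ := IsLocalization.integerNormalization_spec (nonZeroDivisors A) u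
  obtain ⟨t, ht0, ht⟩ := IsLocalization.integerNormalization_spec (nonZeroDivisors A) v
  set u₀ := IsLocalization.integerNormalization (nonZeroDivisors A) u
  set v₀ := IsLocalization.integerNormalization (nonZeroDivisors A) v
  refine ⟨s * t, nonZeroDivisors.ne_zero (mul_mem hs0 ht0), C t * u₀, C s * v₀, ?_⟩
  apply Polynomial.map_injective _ (IsFractionRing.injective A F)
  simp only [Polynomial.map_add, Polynomial.map_mul, Polynomial.map_C, hs, ht, Algebra.smul_def,
    Polynomial.algebraMap_apply, map_mul, F]
  linear_combination (-C (algebraMap A F s) * C (algebraMap A F t)) * huv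

/-! ### Reduction of differential polynomials modulo an irreducible one -/

section Jets

variable {k U : Type*} [Field k] [Field U] [Differential U] [Algebra k U]

/-- The `i`-th derivative of `a`. -/
abbrev jet {U : Type*} [CommRing U] [Differential U] (a : U) (i : ℕ) : U :=
  (fun x : U => x′)^[i] a

theorem jet_succ {U : Type*} [CommRing U] [Differential U] (a : U) (i : ℕ) :
    jet a (i + 1) = (jet a i)′ :=
  Function.iterate_succ_apply' _ _ _

variable (k) in
/-- Evaluation at the jet of `x` of a differential polynomial of order at most `m`, seen as a
polynomial in the `m`-th derivative. -/
noncomputable def jetEval (m : ℕ) (x : U) : Polynomial (MvPolynomial (Fin m) k) →+* U :=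
  Polynomial.eval₂RingHom
    (MvPolynomial.aeval (R := k) fun i : Fin m => jet x i).toRingHom (jet x m)

variable {m : ℕ}

@[simp] theorem jetEval_C (x : U) (f : MvPolynomial (Fin m) k) :
    jetEval k m x (Polynomial.C f) = MvPolynomial.aeval (fun i : Fin m => jet x i) f := by
  simp [jetEval]

@[simp] theorem jetEval_X (x : U) : jetEval k m x Polynomial.X = jet x m := by
  simp [jetEval]

/-- The point is that `F` does not depend on `x`. The hypothesis `hk` says that the image of `k` is
stable under the derivation. -/
theorem exists_jetEval_eq_deriv_aeval (hk : ∀ c : k, ∃ c' : k, (algebraMap k U c)′ = algebraMap k U c')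
    (f : MvPolynomial (Fin m) k) :
    ∃ F : Polynomial (MvPolynomial (Fin m) k), ∀ x : U,
      (MvPolynomial.aeval (fun i : Fin m => jet x i) f)′ = jetEval k m x F := by
  induction f using MvPolynomial.induction_on with
  | C c =>
    obtain ⟨c', hc'⟩ := hk c
    exact ⟨Polynomial.C (MvPolynomial.C c'), fun x => by simp [hc']⟩
  | add p q hp hq =>
    obtain ⟨F, hF⟩ := hp
    obtain ⟨G, hG⟩ := hq
    exact ⟨F + G, fun x => by simp [hF, hG]⟩
  | mul_X p i hp =>
    obtain ⟨F, hF⟩ := hp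
    have hi : ∃ G : Polynomial (MvPolynomial (Fin m) k), ∀ x : U,
        jet x (i + 1) = jetEval k m x G := by
      by_cases h : (i : ℕ) + 1 < m
      · exact ⟨Polynomial.C (MvPolynomial.X ⟨i + 1, h⟩), fun x => by simp⟩
      · have h' : (i : ℕ) + 1 = m := by omega
        exact ⟨Polynomial.X, fun x => by rw [jetEval_X, h']⟩
    obtain ⟨G, hG⟩ := hi
    refine ⟨Polynomial.C p * G + Polynomial.C (MvPolynomial.X i) * F, fun x => ?_⟩
    rw [map_mul, MvPolynomial.aeval_X, Derivation.leibniz, hF, ← jet_succ, hG]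
    simp

/-- This is the chain rule: only `∂F/∂T_m` multiplies the new derivative, and `G` collects the terms
of order at most `m`. -/
theorem exists_jetEval_eq_deriv_jetEval
    (hk : ∀ c : k, ∃ c' : k, (algebraMap k U c)′ = algebraMap k U c')
    (F : Polynomial (MvPolynomial (Fin m) k)) :
    ∃ G : Polynomial (MvPolynomial (Fin m) k), ∀ x : U,
      (jetEval k m x F)′ =
        jetEval k m x G + jetEval k m x (Polynomial.derivative F) * jet x (m + 1) := by
  induction F using Polynomial.induction_on with
  | C f =>
    obtain ⟨G, hG⟩ := exists_jetEval_eq_deriv_aeval hk f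
    exact ⟨G, fun x => by simp [hG]⟩
  | add p q hp hq =>
    obtain ⟨F, hF⟩ := hp
    obtain ⟨G, hG⟩ := hq
    exact ⟨F + G, fun x => by simp only [map_add, hF, hG]; ring⟩
  | monomial n f h =>
    obtain ⟨G, hG⟩ := h
    refine ⟨G * Polynomial.X, fun x => ?_⟩
    rw [pow_succ, ← mul_assoc, map_mul, Derivation.leibniz, hG,
      Polynomial.derivative_mul (f := Polynomial.C f * Polynomial.X ^ n), jetEval_X, ← jet_succ]
    simp only [smul_eq_mul, map_add, map_mul, jetEval_X, Polynomial.derivative_X, map_one]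
    ring

/-- A function `g` on `U` reduces modulo `P` if, on the zeros of `P`, it is a polynomial in the jet
of order `m`, up to a power of the separant of `P`. -/
def ReducesMod (P : Polynomial (MvPolynomial (Fin m) k)) (g : U → U) : Prop :=
  ∃ (e : ℕ) (F : Polynomial (MvPolynomial (Fin m) k)), ∀ x : U, jetEval k m x P = 0 →
    jetEval k m x (Polynomial.derivative P) ^ e * g x = jetEval k m x F

namespace ReducesMod

variable {P : Polynomial (MvPolynomial (Fin m) k)} {g h : U → U}

theorem add (hg : ReducesMod P g) (hh : ReducesMod P h) : ReducesMod P (fun x => g x + h x) := by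
  obtain ⟨e, F, hF⟩ := hg
  obtain ⟨f, G, hG⟩ := hh
  refine ⟨e + f, Polynomial.derivative P ^ f * F + Polynomial.derivative P ^ e * G,
    fun x hx => ?_⟩
  rw [map_add, map_mul, map_mul, ← hF x hx, ← hG x hx, map_pow, map_pow]
  ring

theorem mul (hg : ReducesMod P g) (hh : ReducesMod P h) : ReducesMod P (fun x => g x * h x) := by
  obtain ⟨e, F, hF⟩ := hg
  obtain ⟨f, G, hG⟩ := hh
  refine ⟨e + f, F * G, fun x hx => ?_⟩
  rw [map_mul, ← hF x hx, ← hG x hx]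
  ring

theorem const (P : Polynomial (MvPolynomial (Fin m) k)) (c : k) :
    ReducesMod P (fun _ => algebraMap k U c) :=
  ⟨0, Polynomial.C (MvPolynomial.C c), fun x _ => by simp⟩

theorem deriv (hk : ∀ c : k, ∃ c' : k, (algebraMap k U c)′ = algebraMap k U c')
    (hg : ReducesMod P g) : ReducesMod P (fun x => (g x)′) := by
  obtain ⟨e, F, hF⟩ := hg
  have key : ∀ F : Polynomial (MvPolynomial (Fin m) k),
      ∃ G : Polynomial (MvPolynomial (Fin m) k), ∀ x : U, jetEval k m x P = 0 →
        jetEval k m x (Polynomial.derivative P) * (jetEval k m x F)′ = jetEval k m x G := by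
    intro F
    obtain ⟨P₁, hP₁⟩ := exists_jetEval_eq_deriv_jetEval hk P
    obtain ⟨F₁, hF₁⟩ := exists_jetEval_eq_deriv_jetEval hk F
    -- Eliminate `jet x (m + 1)` between the derivative of `F` and the derivative of `P(x) = 0`.
    refine ⟨Polynomial.derivative P * F₁ - Polynomial.derivative F * P₁, fun x hx => ?_⟩
    have h := hP₁ x
    rw [hx, map_zero] at h
    rw [hF₁, map_sub, map_mul, map_mul]
    linear_combination -jetEval k m x (Polynomial.derivative F) * h
  obtain ⟨F₁, hF₁⟩ := key F
  obtain ⟨S₁, hS₁⟩ := key (Polynomial.derivative P)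
  obtain ⟨S, hS⟩ : ∃ S, S = Polynomial.derivative P := ⟨_, rfl⟩
  rw [← hS] at hF hF₁ hS₁
  -- Differentiate `S ^ e * g = F`, multiply by `S ^ (e + 1)` and replace `S ^ e * g` by `F`. For `e
  -- = 0` the truncated exponent `e - 1` is harmless because of the factor `e`.
  refine ⟨2 * e + 1, S ^ e * F₁ - (e : Polynomial (MvPolynomial (Fin m) k)) * S ^ (e - 1) * S₁ * F,
    fun x hx => ?_⟩
  have h := congrArg (fun y : U => y′) (hF x hx)
  simp only [Derivation.leibniz, Derivation.leibniz_pow, smul_eq_mul, nsmul_eq_mul] at h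
  rw [← hS, map_sub, map_mul, map_mul, map_mul, map_mul, map_pow, map_pow, map_natCast,
    ← hF₁ x hx, ← hS₁ x hx, ← h, ← hF x hx]
  ring

theorem jet (hk : ∀ c : k, ∃ c' : k, (algebraMap k U c)′ = algebraMap k U c') (i : ℕ) :
    ReducesMod P (fun x : U => jet x i) := by
  induction i with
  | zero =>
    rcases Nat.eq_zero_or_pos m with rfl | h
    · exact ⟨0, Polynomial.X, fun x _ => by simp⟩
    · exact ⟨0, Polynomial.C (MvPolynomial.X ⟨0, h⟩), fun x _ => by simp⟩
  | succ i ih => simpa only [jet_succ] using ih.deriv hk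

theorem diffEval (hk : ∀ c : k, ∃ c' : k, (algebraMap k U c)′ = algebraMap k U c')
    (G : MvPolynomial ℕ k) : ReducesMod P (fun x : U => diffEval x G) := by
  induction G using MvPolynomial.induction_on with
  | C c => simpa [_root_.diffEval] using const P c
  | add p q hp hq => simpa [_root_.diffEval] using hp.add hq
  | mul_X p i hp => simpa [_root_.diffEval] using hp.mul (jet hk i)

end ReducesMod

section Generic

variable {P : Polynomial (MvPolynomial (Fin m) k)} (hP : Irreducible P) (hdeg : P.natDegree ≠ 0)
include hP hdeg

/-- The eliminant `H` vanishes at every common zero of `P` and `G`. It trades an inequation of order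
`m` for one of smaller order, as the axiom of differential closedness demands. -/
theorem exists_ne_zero_forall_jetEval_ne_zero {G : Polynomial (MvPolynomial (Fin m) k)}
    (hG : ¬ P ∣ G) : ∃ H : MvPolynomial (Fin m) k, H ≠ 0 ∧ ∀ x : U, jetEval k m x P = 0 →
      MvPolynomial.aeval (fun i : Fin m => jet x i) H ≠ 0 → jetEval k m x G ≠ 0 := by
  let _ : NormalizedGCDMonoid (MvPolynomial (Fin m) k) := Classical.choice inferInstance
  obtain ⟨H, hH, u, v, huv⟩ := Polynomial.exists_C_eq_mul_add_mul_of_irreducible hP hdeg hG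
  refine ⟨H, hH, fun x hx hHx h => hHx ?_⟩
  rw [← jetEval_C, huv, map_add, map_mul, map_mul, hx, h, mul_zero, mul_zero, add_zero]

variable {a : U} (ha : AlgebraicIndependent k fun i : Fin m => jet a i)
  (hPa : jetEval k m a P = 0)
include hPa

theorem exists_ne_zero_forall_jetEval_ne_zero' {G : Polynomial (MvPolynomial (Fin m) k)}
    (hG : jetEval k m a G ≠ 0) : ∃ H : MvPolynomial (Fin m) k, H ≠ 0 ∧ ∀ x : U,
      jetEval k m x P = 0 → MvPolynomial.aeval (fun i : Fin m => jet x i) H ≠ 0 →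
        jetEval k m x G ≠ 0 := by
  refine exists_ne_zero_forall_jetEval_ne_zero hP hdeg fun ⟨q, hq⟩ => hG ?_
  rw [hq, map_mul, hPa, zero_mul]

include ha

/-- Otherwise the eliminant would be a nontrivial algebraic relation among the first `m` derivatives
of `a`. -/
theorem dvd_of_jetEval_eq_zero {G : Polynomial (MvPolynomial (Fin m) k)}
    (hG : jetEval k m a G = 0) : P ∣ G := by
  by_contra h
  obtain ⟨H, hH, hH'⟩ := exists_ne_zero_forall_jetEval_ne_zero (U := U) hP hdeg h
  exact hH' a hPa (fun h0 => hH (ha.eq_zero_of_aeval_eq_zero H h0)) hG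

theorem jetEval_derivative_ne_zero [CharZero k] :
    jetEval k m a (Polynomial.derivative P) ≠ 0 := by
  intro h
  have h1 := Polynomial.natDegree_le_of_dvd (dvd_of_jetEval_eq_zero hP hdeg ha hPa h)
    (fun h0 => hdeg (Polynomial.derivative_eq_zero.1 h0))
  have h2 := Polynomial.natDegree_derivative_lt hdeg
  omega

variable (hk : ∀ c : k, ∃ c' : k, (algebraMap k U c)′ = algebraMap k U c')
include hk

/-- The reduction `F` of `G` vanishes at `a`, so `P` divides it and it vanishes at `x`; the power of
the separant can then be cancelled. -/
theorem diffEval_eq_zero_of_generic {G : MvPolynomial ℕ k} (hG : diffEval a G = 0) {x : U}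
    (hx : jetEval k m x P = 0) (hSx : jetEval k m x (Polynomial.derivative P) ≠ 0) :
    diffEval x G = 0 := by
  obtain ⟨e, F, hF⟩ := ReducesMod.diffEval (P := P) hk G
  have h := hF a hPa
  beta_reduce at h
  rw [hG, mul_zero] at h
  obtain ⟨q, rfl⟩ := dvd_of_jetEval_eq_zero hP hdeg ha hPa h.symm
  have h' := hF x hx
  rw [map_mul, hx, zero_mul] at h'
  exact (mul_eq_zero.1 h').resolve_left (pow_ne_zero _ hSx)

theorem exists_ne_zero_forall_diffEval_ne_zero [CharZero k] {G : MvPolynomial ℕ k}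
    (hG : diffEval a G ≠ 0) : ∃ H : MvPolynomial (Fin m) k, H ≠ 0 ∧ ∀ x : U,
      jetEval k m x P = 0 → MvPolynomial.aeval (fun i : Fin m => jet x i) H ≠ 0 →
        diffEval x G ≠ 0 := by
  obtain ⟨e, F, hF⟩ := ReducesMod.diffEval (P := P) hk G
  have hFa : jetEval k m a F ≠ 0 := by
    rw [← hF a hPa]
    exact mul_ne_zero (pow_ne_zero _ (jetEval_derivative_ne_zero hP hdeg ha hPa)) hG
  obtain ⟨H, hH, hH'⟩ := exists_ne_zero_forall_jetEval_ne_zero' hP hdeg hPa hFa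
  refine ⟨H, hH, fun x hx hHx h => hH' x hx hHx ?_⟩
  rw [← hF x hx]
  simp only [h, mul_zero]

end Generic

end Jets

/-! ### Specializations in a differentially closed field -/

section Specialization

variable {k U : Type*} [Field k] [Field U] [Differential U] [Algebra k U] {m : ℕ}

/-- The variables `T₀, …, Tₘ`, with `Tₘ` singled out. -/
abbrev jetVar (m : ℕ) (o : Option (Fin m)) : ℕ := o.elim m fun i => i

theorem jetVar_injective (m : ℕ) : Function.Injective (jetVar m) := by
  rintro (_ | i) (_ | j) h
  · rfl
  · exact absurd h (Nat.ne_of_gt j.2)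
  · exact absurd h (Nat.ne_of_lt i.2)
  · exact congrArg some (Fin.ext h)

theorem jetVar_le (o : Option (Fin m)) : jetVar m o ≤ m := by
  cases o with
  | none => exact le_rfl
  | some i => exact i.2.le

theorem jetEval_optionEquivLeft (x : U) (q : MvPolynomial (Option (Fin m)) k) :
    jetEval k m x (MvPolynomial.optionEquivLeft k (Fin m) q) =
      MvPolynomial.aeval (fun o => jet x (jetVar m o)) q := by
  induction q using MvPolynomial.induction_on with
  | C c => simp [MvPolynomial.optionEquivLeft_C]
  | add p q hp hq => simp [hp, hq]
  | mul_X p o hp =>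
    cases o with
    | none => simp [hp, MvPolynomial.optionEquivLeft_X_none]
    | some i => simp [hp, MvPolynomial.optionEquivLeft_X_some]

theorem jetEval_optionEquivLeft_eq_diffEval (x : U) (q : MvPolynomial (Option (Fin m)) k) :
    jetEval k m x (MvPolynomial.optionEquivLeft k (Fin m) q) =
      diffEval x (MvPolynomial.rename (jetVar m) q) := by
  rw [jetEval_optionEquivLeft, diffEval, MvPolynomial.aeval_rename]
  rfl

theorem diffEval_map (x : U) (G : MvPolynomial ℕ k) :
    diffEval x (MvPolynomial.map (algebraMap k U) G) = diffEval x G := by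
  rw [diffEval, diffEval, MvPolynomial.aeval_map_algebraMap]

theorem diffOrder_map_rename {L : Type*} [Field L] (f : k →+* L)
    {q : MvPolynomial (Option (Fin m)) k} (hq : q.degreeOf none ≠ 0) :
    diffOrder (MvPolynomial.map f (MvPolynomial.rename (jetVar m) q)) = m := by
  rw [diffOrder, MvPolynomial.vars_map_of_injective _ f.injective]
  apply le_antisymm
  · refine Finset.max_le fun i hi => ?_
    obtain ⟨o, -, rfl⟩ := MvPolynomial.mem_vars_rename _ _ hi
    exact WithBot.coe_le_coe.2 (jetVar_le o)
  · refine Finset.le_max (MvPolynomial.mem_vars_iff_degreeOf_ne_zero.2 ?_)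
    rwa [← MvPolynomial.degreeOf_rename_of_injective (jetVar_injective m)] at hq

theorem exists_rename_jetVar_eq {f : MvPolynomial ℕ k} (hf : diffOrder f = m) :
    ∃ q : MvPolynomial (Option (Fin m)) k, MvPolynomial.rename (jetVar m) q = f ∧
      q.degreeOf none ≠ 0 := by
  obtain ⟨q, hq⟩ := MvPolynomial.exists_rename_eq_of_vars_subset_range f (jetVar m)
    (jetVar_injective m) fun i hi => by
      have h : ((i : ℕ) : WithBot ℕ) ≤ m := hf ▸ Finset.le_max hi
      rcases (Nat.cast_le.1 h).lt_or_eq with h | rfl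
      · exact ⟨some ⟨i, h⟩, rfl⟩
      · exact ⟨none, rfl⟩
  refine ⟨q, hq, ?_⟩
  have h := MvPolynomial.mem_vars_iff_degreeOf_ne_zero.1 (Finset.mem_of_max hf)
  rw [← hq] at h
  rwa [← MvPolynomial.degreeOf_rename_of_injective (jetVar_injective m)]

theorem irreducible_of_rename {σ τ : Type*} {f : σ → τ} (hf : Function.Injective f)
    {q : MvPolynomial σ k} (hq : Irreducible (MvPolynomial.rename f q)) : Irreducible q := by
  have hunit : ∀ p : MvPolynomial σ k, IsUnit (MvPolynomial.rename f p) → IsUnit p := fun p hp => by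
    simpa using! hp.map (MvPolynomial.killCompl (R := k) hf)
  refine ⟨fun h => hq.not_isUnit (h.map _), fun a b hab => ?_⟩
  rw [hab, map_mul] at hq
  exact (hq.isUnit_or_isUnit rfl).imp (hunit a) (hunit b)

theorem IsDifferentiallyClosed.isAlgClosed (hclosed : IsDifferentiallyClosed U) :
    IsAlgClosed U := by
  refine IsAlgClosed.of_exists_root U fun p hp hirr => ?_
  set P : MvPolynomial ℕ U := Polynomial.aeval (MvPolynomial.X 0) p with hPdef
  have hev : ∀ x : U, diffEval x P = p.eval x := fun x => by
    rw [hPdef, diffEval, ← Polynomial.aeval_algHom_apply, MvPolynomial.aeval_X]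
    simp
  -- Substituting `X` for all variables recovers `p`, so `P` is neither zero nor constant.
  have hback : MvPolynomial.aeval (fun _ : ℕ => (Polynomial.X : Polynomial U)) P = p := by
    rw [hPdef, ← Polynomial.aeval_algHom_apply, MvPolynomial.aeval_X, Polynomial.aeval_X_left_apply]
  have hP0 : P ≠ 0 := fun h => hirr.ne_zero (by rw [← hback, h, map_zero])
  have hord : diffOrder (1 : MvPolynomial ℕ U) < diffOrder P := by
    rw [diffOrder, MvPolynomial.vars_one, Finset.max_empty, bot_lt_iff_ne_bot, diffOrder, Ne,
      Finset.max_eq_bot]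
    intro h
    have hc := MvPolynomial.vars_eq_empty_iff_eq_C.1 h
    apply hirr.natDegree_pos.ne'
    rw [← hback, hc]
    simp
  obtain ⟨x, hx, -⟩ := hclosed P 1 hP0 one_ne_zero hord
  exact ⟨x, by rw [← hev, hx]⟩

/-- A zero of a nonzero differential polynomial is a generic zero of an irreducible one. -/
theorem exists_irreducible_jetEval_eq_zero {a : U}
    (hdep : ∃ f : MvPolynomial ℕ k, f ≠ 0 ∧ diffEval a f = 0) :
    ∃ (m : ℕ) (P : Polynomial (MvPolynomial (Fin m) k)), Irreducible P ∧ P.natDegree ≠ 0 ∧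
      (AlgebraicIndependent k fun i : Fin m => jet a i) ∧ jetEval k m a P = 0 := by
  classical
  have hex : ∃ m : ℕ, ¬ AlgebraicIndependent k fun i : Fin m => jet a i := by
    obtain ⟨f, hf0, hf⟩ := hdep
    obtain ⟨M, hM⟩ := f.vars.exists_nat_subset_range
    obtain ⟨q, rfl⟩ := MvPolynomial.exists_rename_eq_of_vars_subset_range f (Fin.val (n := M))
      Fin.val_injective fun i hi => ⟨⟨i, Finset.mem_range.1 (hM hi)⟩, rfl⟩
    refine ⟨M, fun h => hf0 ?_⟩
    rw [diffEval, MvPolynomial.aeval_rename] at hf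
    rw [h.eq_zero_of_aeval_eq_zero q hf, map_zero]
  -- Take the shortest dependent jet, of length `m + 1`; `P` will be an irreducible factor of a
  -- relation, and it involves `T_m` because the shorter jet is independent.
  obtain ⟨n, hn⟩ : ∃ n, n = Nat.find hex := ⟨_, rfl⟩
  have hnot := Nat.find_spec hex
  have hmin := fun j => Nat.find_min hex (m := j)
  rw [← hn] at hnot
  rw [← hn] at hmin
  obtain _ | m := n
  · exact absurd (algebraicIndependent_empty_type_iff.2 (algebraMap k U).injective) hnot
  have hAI : AlgebraicIndependent k fun i : Fin m => jet a i := not_not.1 (hmin m m.lt_succ_self)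
  have hnot' : ¬ AlgebraicIndependent k fun o : Option (Fin m) => jet a (jetVar m o) := by
    refine fun h => hnot ?_
    convert! (algebraicIndependent_equiv finSuccEquivLast).2 h using 2 with i
    refine Fin.lastCases ?_ (fun i => ?_) i <;> simp
  rw [algebraicIndependent_iff] at hnot'
  push Not at hnot'
  obtain ⟨q, hq, hq0⟩ := hnot'
  rw [← jetEval_optionEquivLeft] at hq
  have hq0' : MvPolynomial.optionEquivLeft k (Fin m) q ≠ 0 := by
    rwa [EmbeddingLike.map_ne_zero_iff]
  obtain ⟨u, hu⟩ := UniqueFactorizationMonoid.factors_prod hq0'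
  rw [← hu, map_mul, mul_eq_zero, or_iff_left (u.isUnit.map (jetEval k m a)).ne_zero,
    map_multiset_prod, Multiset.prod_eq_zero_iff, Multiset.mem_map] at hq
  obtain ⟨P, hPmem, hPa⟩ := hq
  have hP := UniqueFactorizationMonoid.irreducible_of_factor P hPmem
  refine ⟨m, P, hP, fun hdeg => hP.ne_zero ?_, hAI, hPa⟩
  rw [Polynomial.eq_C_of_natDegree_eq_zero hdeg, jetEval_C] at hPa
  rw [Polynomial.eq_C_of_natDegree_eq_zero hdeg, hAI.eq_zero_of_aeval_eq_zero _ hPa, map_zero]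

/-- For `m > 0` the inequation `T_0 ≠ a` has order below `m`, so differential closedness supplies
`x`. For `m = 0` the element `a` is algebraic over `k` and `x` is another root of its separable
equation. -/
theorem exists_ne_jetEval_eq_zero [CharZero U] (hclosed : IsDifferentiallyClosed U) {a : U}
    (ha : a ∉ Set.range (algebraMap k U)) {P : Polynomial (MvPolynomial (Fin m) k)}
    (hP : Irreducible P) (hdeg : P.natDegree ≠ 0)
    (hAI : AlgebraicIndependent k fun i : Fin m => jet a i) (hPa : jetEval k m a P = 0)
    {H : MvPolynomial (Fin m) k} (hH : H ≠ 0) :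
    ∃ x : U, x ≠ a ∧ jetEval k m x P = 0 ∧
      MvPolynomial.aeval (fun i : Fin m => jet x i) H ≠ 0 := by
  have : CharZero k := ((algebraMap k U).charZero_iff (algebraMap k U).injective).2 inferInstance
  rcases Nat.eq_zero_or_pos m with rfl | hm
  · have := hclosed.isAlgClosed
    set φ : MvPolynomial (Fin 0) k →+* U :=
      (MvPolynomial.aeval (R := k) fun i : Fin 0 => jet a i).toRingHom with hφ
    have hφinj : Function.Injective φ := hAI
    have hjet : ∀ (x : U) (F : Polynomial (MvPolynomial (Fin 0) k)),
        jetEval k 0 x F = (F.map φ).eval x := fun x F => by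
      rw [Polynomial.eval_map, jetEval, hφ, Subsingleton.elim (fun i : Fin 0 => jet x i)
        fun i : Fin 0 => jet a i]
      rfl
    have hroot : (P.map φ).IsRoot a := by rw [Polynomial.IsRoot, ← hjet, hPa]
    obtain ⟨q, hq⟩ := Polynomial.dvd_iff_isRoot.2 hroot
    -- Indeed `q(a)` is the derivative of `P.map φ` at `a`, so `a` is a simple root.
    have hqa : q.eval a ≠ 0 := by
      have h := jetEval_derivative_ne_zero hP hdeg hAI hPa
      rw [hjet, ← Polynomial.derivative_map, hq] at h
      simpa [Polynomial.derivative_mul] using h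
    -- If `q` were constant, `P` would be linear and `a` would lie in `k`.
    have hqdeg : q.degree ≠ 0 := by
      intro h
      have hq0 : q ≠ 0 := by rintro rfl; simp at hqa
      have h1 : P.natDegree = 1 := by
        rw [← Polynomial.natDegree_map_eq_of_injective hφinj, hq,
          Polynomial.natDegree_mul (Polynomial.X_sub_C_ne_zero a) hq0,
          Polynomial.natDegree_eq_of_degree_eq_some h, Polynomial.natDegree_X_sub_C]
        rfl
      have hrange : ∀ f : MvPolynomial (Fin 0) k, φ f ∈ Set.range (algebraMap k U) := fun f => by
        rw [MvPolynomial.eq_C_of_isEmpty f, hφ]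
        exact ⟨_, (MvPolynomial.aeval_C _ _).symm⟩
      rw [Polynomial.eq_X_add_C_of_natDegree_le_one h1.le] at hPa
      obtain ⟨α, hα⟩ := hrange (P.coeff 1)
      obtain ⟨β, hβ⟩ := hrange (P.coeff 0)
      have hα0 : algebraMap k U α ≠ 0 := by
        rw [hα, Ne, map_eq_zero_iff φ hφinj, ← h1, Polynomial.coeff_natDegree,
          Polynomial.leadingCoeff_eq_zero]
        exact hP.ne_zero
      refine ha ⟨-β / α, ?_⟩
      have h2 : algebraMap k U α * a + algebraMap k U β = 0 := by
        rw [hα, hβ, ← hPa, hjet]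
        simp
      rw [map_div₀, map_neg, div_eq_iff hα0]
      linear_combination -h2
    obtain ⟨x, hx⟩ := IsAlgClosed.exists_root q hqdeg
    refine ⟨x, fun h => hqa (h ▸ hx), ?_, ?_⟩
    · rw [hjet, hq, Polynomial.eval_mul, hx.eq_zero, mul_zero]
    · rw [Subsingleton.elim (fun i : Fin 0 => jet x i) fun i : Fin 0 => jet a i]
      exact fun h => hH (hAI.eq_zero_of_aeval_eq_zero H h)
  · obtain ⟨q, rfl⟩ := (MvPolynomial.optionEquivLeft k (Fin m)).surjective P
    rw [MvPolynomial.natDegree_optionEquivLeft] at hdeg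
    set D : MvPolynomial ℕ U :=
      MvPolynomial.map (algebraMap k U) (MvPolynomial.rename Fin.val H) with hD
    have hD0 : D ≠ 0 := by
      rw [hD, Ne, map_eq_zero_iff _ (MvPolynomial.map_injective _ (algebraMap k U).injective),
        map_eq_zero_iff _ (MvPolynomial.rename_injective _ Fin.val_injective)]
      exact hH
    have hXa : (MvPolynomial.X 0 - MvPolynomial.C a : MvPolynomial ℕ U) ≠ 0 := by
      intro h
      have := congrArg (MvPolynomial.eval fun _ => a + 1) h
      simp at this
    have hord := diffOrder_map_rename (algebraMap k U) hdeg
    obtain ⟨x, hx, hx'⟩ := hclosed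
      (MvPolynomial.map (algebraMap k U) (MvPolynomial.rename (jetVar m) q))
      (D * (MvPolynomial.X 0 - MvPolynomial.C a))
      (by
        rintro h
        rw [h, diffOrder, MvPolynomial.vars_0, Finset.max_empty] at hord
        exact WithBot.bot_ne_coe hord)
      (mul_ne_zero hD0 hXa)
      (by
        classical
        rw [hord, diffOrder]
        refine (Finset.max_le (M := ((m - 1 : ℕ) : WithBot ℕ)) fun i hi => ?_).trans_lt
          (WithBot.coe_lt_coe.2 (Nat.sub_lt hm one_pos))
        refine WithBot.coe_le_coe.2 (Nat.le_sub_one_of_lt ?_)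
        rcases Finset.mem_union.1 (MvPolynomial.vars_mul _ _ hi) with h | h
        · obtain ⟨j, -, rfl⟩ := MvPolynomial.mem_vars_rename _ _ (MvPolynomial.vars_map _ _ h)
          exact j.2
        · have h := MvPolynomial.vars_sub_subset _ h
          rw [MvPolynomial.vars_X, MvPolynomial.vars_C, Finset.union_empty,
            Finset.mem_singleton] at h
          omega)
    rw [diffEval_map, ← jetEval_optionEquivLeft_eq_diffEval] at hx
    rw [diffEval, map_mul, mul_ne_zero_iff] at hx'
    refine ⟨x, ?_, hx, ?_⟩
    · rintro rfl
      simp at hx'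
    · rw [hD, MvPolynomial.aeval_map_algebraMap, MvPolynomial.aeval_rename] at hx'
      exact hx'.1

/-- An element `a` outside of a differential field `k` which satisfies a differential equation over
`k` has a specialization over `k`, different from `a`, that avoids a given inequation. -/
theorem exists_ne_specialization [CharZero U] (hclosed : IsDifferentiallyClosed U)
    (hk : ∀ c : k, ∃ c' : k, (algebraMap k U c)′ = algebraMap k U c') {a : U}
    (hdep : ∃ f : MvPolynomial ℕ k, f ≠ 0 ∧ diffEval a f = 0)
    (ha : a ∉ Set.range (algebraMap k U)) {h : MvPolynomial ℕ k} (hh : diffEval a h ≠ 0) :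
    ∃ x : U, x ≠ a ∧ (∀ G : MvPolynomial ℕ k, diffEval a G = 0 → diffEval x G = 0) ∧
      diffEval x h ≠ 0 := by
  have : CharZero k := ((algebraMap k U).charZero_iff (algebraMap k U).injective).2 inferInstance
  obtain ⟨m, P, hP, hdeg, hAI, hPa⟩ := exists_irreducible_jetEval_eq_zero hdep
  -- `H₁` keeps the separant nonzero, so that all equations of `a` pass to `x`; `H₂` preserves the
  -- given inequation.
  obtain ⟨H₁, hH₁, hH₁'⟩ := exists_ne_zero_forall_jetEval_ne_zero' hP hdeg hPa
    (jetEval_derivative_ne_zero hP hdeg hAI hPa)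
  obtain ⟨H₂, hH₂, hH₂'⟩ := exists_ne_zero_forall_diffEval_ne_zero hP hdeg hAI hPa hk hh
  obtain ⟨x, hxa, hx, hHx⟩ := exists_ne_jetEval_eq_zero hclosed ha hP hdeg hAI hPa
    (mul_ne_zero hH₁ hH₂)
  rw [map_mul, mul_ne_zero_iff] at hHx
  exact ⟨x, hxa, fun G hG => diffEval_eq_zero_of_generic hP hdeg hAI hPa hk hG hx
    (hH₁' x hx hHx.1), hH₂' x hx hHx.2⟩

end Specialization

/-! ### Transfer of algebraic independence -/

/-- Extend `X` to a basis `B` of the closure of `I`. Then `B ∪ J` has rank `|I| + |J| = |B| + |J|`,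
so it is independent and the union is disjoint. -/
theorem Matroid.Indep.union_of_subset_closure {α : Type*} {M : Matroid α} {I J X : Set α}
    (hIJ : M.Indep (I ∪ J)) (hdisj : Disjoint I J) (hfin : (I ∪ J).Finite) (hX : M.Indep X)
    (hXI : X ⊆ M.closure I) : M.Indep (X ∪ J) ∧ Disjoint X J := by
  obtain ⟨B, hB, hXB⟩ := hX.subset_isBasis_of_subset hXI
  have hI : M.Indep I := hIJ.subset Set.subset_union_left
  have hIfin : I.Finite := hfin.subset Set.subset_union_left
  have hJfin : J.Finite := hfin.subset Set.subset_union_right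
  have hBI : B.encard = I.encard := by
    rw [hB.encard_eq_eRk, M.eRk_closure_eq, hI.eRk_eq_encard]
  have hBfin : B.Finite := Set.encard_lt_top_iff.1 (hBI ▸ hIfin.encard_lt_top)
  have hrk : I.encard + J.encard ≤ M.eRk (B ∪ J) := by
    rw [← Set.encard_union_eq hdisj, ← hIJ.eRk_eq_encard, hB.eRk_eq_eRk_union,
      M.eRk_union_closure_left_eq]
  have hle : I.encard + J.encard ≤ (B ∪ J).encard := hrk.trans (M.eRk_le_encard _)
  have hBJ : (B ∪ J).encard ≤ I.encard + J.encard := hBI ▸ Set.encard_union_le B J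
  have hindep : M.Indep (B ∪ J) := by
    rw [Matroid.indep_iff_eRk_eq_encard_of_finite (hBfin.union hJfin)]
    exact le_antisymm (M.eRk_le_encard _) (hBJ.trans hrk)
  refine ⟨hindep.subset (Set.union_subset_union_left J hXB), Disjoint.mono_left hXB ?_⟩
  have h := Set.encard_union_add_encard_inter B J
  rw [le_antisymm hBJ hle, hBI] at h
  have hne : I.encard + J.encard ≠ ⊤ := by
    rw [← Set.encard_union_eq hdisj]
    exact hfin.encard_lt_top.ne
  rw [Set.disjoint_iff_inter_eq_empty, ← Set.encard_eq_zero]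
  exact (WithTop.add_left_inj hne).1 (h.trans (add_zero _).symm)

/-- Independence passes from `K` to `K[J]`, then to the algebraic closure of `K[J]` in `U`, which
contains `B`. -/
theorem AlgebraicIndependent.extendScalars_of_forall_mem_closure {K U : Type*} [Field K] [Field U]
    [Algebra K U] (B : IntermediateField K U) {J : Set U} {ι : Type*} {x : ι → U}
    (hx : AlgebraicIndependent K x)
    (hxJ : (AlgebraicIndependent.matroid K U).Indep (Set.range x ∪ J))
    (hdisj : Disjoint (Set.range x) J)
    (hB : ∀ y ∈ B, y ∈ (AlgebraicIndependent.matroid K U).closure J) :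
    AlgebraicIndependent B x := by
  rw [AlgebraicIndependent.matroid_closure_eq] at hB
  have h1 : AlgebraicIndependent (Algebra.adjoin K J) x := by
    have h := (AlgebraicIndependent.matroid_indep_iff.1 hxJ).adjoin_of_disjoint
      (s := Subtype.val ⁻¹' J) (t := Subtype.val ⁻¹' Set.range x) (hdisj.symm.preimage _)
    have himage : (fun i : ↥(Set.range x ∪ J) => id (i : U)) '' (Subtype.val ⁻¹' J) = J := by
      ext y
      simp only [id, Set.mem_image, Set.mem_preimage, Subtype.exists]
      exact ⟨fun ⟨z, _, hz, h⟩ => h ▸ hz, fun hy => ⟨y, Or.inr hy, hy, rfl⟩⟩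
    rw [himage] at h
    exact h.comp (fun i : ι => ⟨⟨x i, Or.inl ⟨i, rfl⟩⟩, ⟨i, rfl⟩⟩) fun i j hij =>
      hx.injective (congrArg (fun z => ((z.1 : ↥(Set.range x ∪ J)) : U)) hij)
  have h2 := h1.subalgebraAlgebraicClosure
  let C := Subalgebra.algebraicClosure (Algebra.adjoin K J) U
  let f : B →+* C := (algebraMap B U).codRestrict C fun y => hB y y.2
  let _ : Algebra B C := f.toAlgebra
  have : IsScalarTower B C U := .of_algebraMap_eq fun _ => rfl
  exact h2.restrictScalars f.injective

/-! ### Generated differential subfields -/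

section DiffAdjoin

variable {U : Type*} [Field U] [Differential U] {K : Subfield U}

theorem subset_diffAdjoin (S : Set U) : S ⊆ diffAdjoin K S := fun x hx => by
  rw [SetLike.mem_coe, diffAdjoin, IntermediateField.mem_sInf]
  exact fun L hL => hL.2 hx

theorem deriv_mem_diffAdjoin {S : Set U} {x : U} (hx : x ∈ diffAdjoin K S) :
    x′ ∈ diffAdjoin K S := by
  rw [diffAdjoin, IntermediateField.mem_sInf] at hx ⊢
  exact fun L hL => hL.1 x (hx L hL)

theorem jet_mem_diffAdjoin (a : U) (i : ℕ) : jet a i ∈ diffAdjoin K {a} := by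
  induction i with
  | zero => exact subset_diffAdjoin _ rfl
  | succ i ih => exact jet_succ a i ▸ deriv_mem_diffAdjoin ih

theorem diffAdjoin_singleton (hK : IsDifferentialSubfield K) (a : U) :
    diffAdjoin K {a} = IntermediateField.adjoin K (Set.range (jet a)) := by
  apply le_antisymm
  · refine sInf_le ⟨fun x hx => ?_, Set.singleton_subset_iff.2
      (IntermediateField.subset_adjoin _ _ ⟨0, rfl⟩)⟩
    induction hx using IntermediateField.adjoin_induction with
    | mem x hx =>
      obtain ⟨i, rfl⟩ := hx
      exact IntermediateField.subset_adjoin _ _ ⟨i + 1, jet_succ a i⟩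
    | algebraMap c =>
      exact IntermediateField.algebraMap_mem _ (⟨_, hK c c.2⟩ : K)
    | add x y _ _ hx' hy' => exact map_add (Differential.deriv : Derivation ℤ U U) x y ▸ add_mem hx' hy'
    | inv x hx hx' =>
      rw [Derivation.leibniz_inv]
      exact mul_mem (neg_mem (pow_mem (inv_mem hx) 2)) hx'
    | mul x y hx hy hx' hy' =>
      rw [Derivation.leibniz]
      exact add_mem (mul_mem hx hy') (mul_mem hy hx')
  · rw [IntermediateField.adjoin_le_iff]
    rintro _ ⟨i, rfl⟩
    exact jet_mem_diffAdjoin a i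

theorem isAlgebraic_diffAdjoin_iff (hK : IsDifferentialSubfield K) (a y : U) :
    IsAlgebraic (diffAdjoin K {a}) y ↔ IsAlgebraic (Algebra.adjoin K (Set.range (jet a))) y := by
  rw [diffAdjoin_singleton hK, IntermediateField.isAlgebraic_adjoin_iff]

theorem isAlgebraic_diffAdjoin_iff_mem_closure (hK : IsDifferentialSubfield K) (a y : U) :
    IsAlgebraic (diffAdjoin K {a}) y ↔
      y ∈ (AlgebraicIndependent.matroid K U).closure (Set.range (jet a)) := by
  rw [isAlgebraic_diffAdjoin_iff hK, AlgebraicIndependent.matroid_closure_eq]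
  rfl

/-- Being algebraic over `K⟨a⟩` is witnessed by a differential equation and an inequation. -/
theorem exists_diffEval_of_isAlgebraic (hK : IsDifferentialSubfield K)
    {k : IntermediateField K U} {a b : U} (hb : b ∈ k) (hab : IsAlgebraic (diffAdjoin K {a}) b) :
    ∃ G h : MvPolynomial ℕ k, diffEval a G = 0 ∧ diffEval a h ≠ 0 ∧
      ∀ x : U, diffEval x G = 0 → diffEval x h ≠ 0 → IsAlgebraic (diffAdjoin K {x}) b := by
  rw [isAlgebraic_diffAdjoin_iff hK] at hab
  obtain ⟨p, hp0, hp⟩ := hab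
  have hg : ∀ j, ∃ g : MvPolynomial ℕ K, diffEval a g = p.coeff j := fun j => by
    have h : ∀ y ∈ Algebra.adjoin K (Set.range (jet a)), ∃ f : MvPolynomial ℕ K,
        diffEval a f = y := fun y hy => by
      rw [Algebra.adjoin_range_eq_range_aeval] at hy
      exact hy
    exact h _ (p.coeff j).2
  choose g hg using hg
  -- The equation `G` says that `b`, viewed as a constant coefficient from `k`, is a root of `∑ g j
  -- * X ^ j`. Nonvanishing of the single coefficient `g j₀` keeps this polynomial nonzero at `x`.
  obtain ⟨j₀, hj₀⟩ := Finset.nonempty_iff_ne_empty.2 (mt Polynomial.support_eq_empty.1 hp0)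
  have hmap : ∀ (x : U) (f : MvPolynomial ℕ K),
      diffEval x (MvPolynomial.map (algebraMap K k) f) = diffEval x f := fun x f =>
    MvPolynomial.aeval_map_algebraMap ..
  have hG : ∀ x : U, diffEval x (∑ j ∈ p.support,
      MvPolynomial.map (algebraMap K k) (g j) * MvPolynomial.C ((⟨b, hb⟩ : k) ^ j)) =
        ∑ j ∈ p.support, diffEval x (g j) * b ^ j := fun x => by
    rw [diffEval, map_sum]
    refine Finset.sum_congr rfl fun j _ => ?_
    rw [map_mul, MvPolynomial.aeval_C, map_pow]
    exact congrArg₂ _ (hmap x (g j)) rfl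
  refine ⟨_, MvPolynomial.map (algebraMap K k) (g j₀), (hG a).trans ?_, ?_, fun x hx hx' => ?_⟩
  · rw [← hp, Polynomial.aeval_def, Polynomial.eval₂_eq_sum, Polynomial.sum_def]
    exact Finset.sum_congr rfl fun j _ => congrArg (· * b ^ j) (hg j)
  · rw [hmap, hg]
    exact fun h => Polynomial.mem_support_iff.1 hj₀ (Subtype.ext h)
  · rw [hG] at hx
    rw [hmap] at hx'
    rw [isAlgebraic_diffAdjoin_iff hK]
    have hmem : ∀ f : MvPolynomial ℕ K, diffEval x f ∈ Algebra.adjoin K (Set.range (jet x)) :=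
      fun f => by
        rw [Algebra.adjoin_range_eq_range_aeval]
        exact ⟨f, rfl⟩
    refine ⟨∑ j ∈ p.support, Polynomial.monomial j
      (⟨diffEval x (g j), hmem _⟩ : Algebra.adjoin K (Set.range (jet x))), fun h => hx' ?_, ?_⟩
    · have h := congrArg (fun q => ((q.coeff j₀ : Algebra.adjoin K (Set.range (jet x))) : U)) h
      simpa [Polynomial.finsetSum_coeff, Polynomial.coeff_monomial, hj₀] using! h
    · rw [map_sum, ← hx]
      refine Finset.sum_congr rfl fun j _ => ?_
      rw [Polynomial.aeval_monomial]
      rfl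

end DiffAdjoin

theorem mem_of_isAlgebraic_of_isAlgClosed {U : Type*} [Field U] {K : Subfield U}
    (hK : IsAlgClosed K) {y : U} (hy : IsAlgebraic K y) : y ∈ K := by
  have h : algebraicClosure K U = ⊥ := IntermediateField.eq_bot_of_isAlgClosed_of_isAlgebraic _
  have hy' : y ∈ algebraicClosure K U := mem_algebraicClosure_iff.2 hy
  rw [h] at hy'
  obtain ⟨c, rfl⟩ := IntermediateField.mem_bot.1 hy'
  exact c.2

/-! ### Consequences of Property D₂ -/

namespace DiffAlgEquation

variable {U : Type*} [Field U] [Differential U] {K : Subfield U} {E : DiffAlgEquation K}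

theorem exists_polynomial (hirr : E.IsIrreducible) :
    ∃ P : Polynomial (MvPolynomial (Fin E.order) K), Irreducible P ∧ P.natDegree ≠ 0 ∧
      ∀ x : U, jetEval K E.order x P = diffEval x E.num := by
  obtain ⟨q, hq, hdeg⟩ := exists_rename_jetVar_eq E.coe_order.symm
  refine ⟨MvPolynomial.optionEquivLeft K _ q, ?_, ?_, fun x => ?_⟩
  · rw [IsIrreducible, ← hq] at hirr
    exact (MulEquiv.irreducible_iff (MvPolynomial.optionEquivLeft K _)).2
      (irreducible_of_rename (jetVar_injective _) hirr)
  · rwa [MvPolynomial.natDegree_optionEquivLeft]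
  · rw [jetEval_optionEquivLeft_eq_diffEval, hq]

theorem PropertyD.algebraicIndependent_pair (hD : E.PropertyD 2) {a₁ a₂ : U}
    (h₁ : E.IsGenericSolution a₁) (h₂ : E.IsGenericSolution a₂) (hne : a₁ ≠ a₂) :
    AlgebraicIndependent K fun p : Fin 2 × Fin E.order => jet (![a₁, a₂] p.1) p.2 := by
  refine hD ![a₁, a₂] ?_ ?_
  · intro i j
    fin_cases i <;> fin_cases j <;> simp [hne, hne.symm]
  · intro j
    fin_cases j
    exacts [h₁, h₂]

theorem PropertyD.algebraicIndependent (hD : E.PropertyD 2) {a₁ a₂ : U}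
    (h₁ : E.IsGenericSolution a₁) (h₂ : E.IsGenericSolution a₂) (hne : a₁ ≠ a₂) :
    AlgebraicIndependent K fun i : Fin E.order => jet a₁ i :=
  (hD.algebraicIndependent_pair h₁ h₂ hne).comp (fun i => ((0 : Fin 2), i))
    (Prod.mk_right_injective _)

theorem PropertyD.indep_union (hD : E.PropertyD 2) {a₁ a₂ : U}
    (h₁ : E.IsGenericSolution a₁) (h₂ : E.IsGenericSolution a₂) (hne : a₁ ≠ a₂) :
    (AlgebraicIndependent.matroid K U).Indep
      (Set.range (fun i : Fin E.order => jet a₁ i) ∪ Set.range fun i : Fin E.order => jet a₂ i) ∧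
    Disjoint (Set.range fun i : Fin E.order => jet a₁ i)
      (Set.range fun i : Fin E.order => jet a₂ i) := by
  have h := hD.algebraicIndependent_pair h₁ h₂ hne
  constructor
  · refine (AlgebraicIndependent.matroid_indep_iff.2 h.to_subtype_range).subset ?_
    rintro _ (⟨i, rfl⟩ | ⟨i, rfl⟩)
    exacts [⟨(0, i), rfl⟩, ⟨(1, i), rfl⟩]
  · rw [Set.disjoint_left]
    rintro _ ⟨i, rfl⟩ ⟨j, hij⟩
    have := h.injective (a₁ := (1, j)) (a₂ := (0, i)) hij
    simp at this

/-- The relation `P` makes the derivative of order `n` algebraic over the lower ones, and every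
further derivative is a quotient of a polynomial in these by a power of the nonzero separant. -/
theorem jet_mem_closure [CharZero U] (hK : IsDifferentialSubfield K) (hirr : E.IsIrreducible)
    {a : U} (ha : E.IsSolution a)
    (hAI : AlgebraicIndependent K fun i : Fin E.order => jet a i) (j : ℕ) :
    jet a j ∈ (AlgebraicIndependent.matroid K U).closure
      (Set.range fun i : Fin E.order => jet a i) := by
  obtain ⟨P, hP, hdeg, hPE⟩ := exists_polynomial (U := U) hirr
  have hPa : jetEval K E.order a P = 0 := (hPE a).trans ha.1
  rw [AlgebraicIndependent.matroid_closure_eq]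
  set R := Algebra.adjoin K (Set.range fun i : Fin E.order => jet a i)
  change IsAlgebraic R (jet a j)
  have hC : ∀ f : MvPolynomial (Fin E.order) K,
      IsAlgebraic R (MvPolynomial.aeval (fun i : Fin E.order => jet a i) f) := fun f => by
    have hf : MvPolynomial.aeval (fun i : Fin E.order => jet a i) f ∈ R :=
      (Algebra.adjoin_range_eq_range_aeval K fun i : Fin E.order => jet a i).ge ⟨f, rfl⟩
    exact isAlgebraic_algebraMap (⟨_, hf⟩ : R)
  have htop : IsAlgebraic R (jet a E.order) := by
    have h := (hAI.option_iff_transcendental (jet a E.order)).not.1 fun h => ?_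
    · rwa [Transcendental, not_not] at h
    obtain ⟨q, rfl⟩ := (MvPolynomial.optionEquivLeft K (Fin E.order)).surjective P
    rw [jetEval_optionEquivLeft] at hPa
    refine hP.ne_zero ?_
    rw [h.eq_zero_of_aeval_eq_zero q ?_, map_zero]
    rw [← hPa]
    congr 2
    ext o
    cases o <;> rfl
  have hev : ∀ F : Polynomial (MvPolynomial (Fin E.order) K),
      IsAlgebraic R (jetEval K E.order a F) := fun F => by
    induction F using Polynomial.induction_on' with
    | add p q hp hq => exact map_add (jetEval K E.order a) p q ▸ hp.add hq
    | monomial n f =>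
      rw [← Polynomial.C_mul_X_pow_eq_monomial, map_mul, map_pow, jetEval_C, jetEval_X]
      exact (hC f).mul (htop.pow n)
  obtain ⟨e, F, hF⟩ := ReducesMod.jet (U := U) (P := P) (fun c : K => ⟨⟨_, hK c c.2⟩, rfl⟩) j
  have hS := pow_ne_zero e (jetEval_derivative_ne_zero hP hdeg hAI hPa)
  have hj : jet a j = _ := eq_div_of_mul_eq hS ((mul_comm _ _).trans (hF a hPa))
  rw [hj, div_eq_mul_inv]
  exact (hev F).mul ((hev _).pow e).inv

theorem mem_closure_of_isAlgebraic_diffAdjoin [CharZero U] (hK : IsDifferentialSubfield K)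
    (hirr : E.IsIrreducible) {a : U} (ha : E.IsSolution a)
    (hAI : AlgebraicIndependent K fun i : Fin E.order => jet a i) {y : U}
    (hy : IsAlgebraic (diffAdjoin K {a}) y) :
    y ∈ (AlgebraicIndependent.matroid K U).closure
      (Set.range fun i : Fin E.order => jet a i) := by
  rw [isAlgebraic_diffAdjoin_iff_mem_closure hK] at hy
  refine Matroid.closure_subset_closure_of_subset_closure ?_ hy
  rintro _ ⟨j, rfl⟩
  exact jet_mem_closure hK hirr ha hAI j

theorem algIndependentFields [CharZero U] (hK : IsDifferentialSubfield K)
    (hirr : E.IsIrreducible) (hD : E.PropertyD 2) {a₁ a₂ : U}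
    (h₁ : E.IsGenericSolution a₁) (h₂ : E.IsGenericSolution a₂) (hne : a₁ ≠ a₂) :
    AlgIndependentFields (diffAdjoin K {a₁}) (diffAdjoin K {a₂}) := by
  intro r x hx hB hxK
  obtain ⟨hindep, hdisj⟩ := hD.indep_union h₁ h₂ hne
  obtain ⟨h, h'⟩ := hindep.union_of_subset_closure hdisj
    ((Set.finite_range _).union (Set.finite_range _))
    (AlgebraicIndependent.matroid_indep_iff.2 hxK.to_subtype_range) (by
      rintro _ ⟨i, rfl⟩
      exact mem_closure_of_isAlgebraic_diffAdjoin hK hirr h₁.1 (hD.algebraicIndependent h₁ h₂ hne)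
        (isAlgebraic_algebraMap (⟨x i, hx i⟩ : diffAdjoin K {a₁})))
  exact hB (hxK.extendScalars_of_forall_mem_closure _ h h' fun y hy =>
    mem_closure_of_isAlgebraic_diffAdjoin hK hirr h₂.1
      (hD.algebraicIndependent h₂ h₁ hne.symm)
      (isAlgebraic_algebraMap (⟨y, hy⟩ : diffAdjoin K {a₂})))

/-- The closures of two disjoint parts of an independent set meet in the closure of the empty set.
-/
theorem isAlgebraic_of_isAlgebraic_diffAdjoin [CharZero U] (hK : IsDifferentialSubfield K)
    (hirr : E.IsIrreducible) (hD : E.PropertyD 2) {a₁ a₂ y : U}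
    (h₁ : E.IsGenericSolution a₁) (h₂ : E.IsGenericSolution a₂) (hne : a₁ ≠ a₂)
    (hy₁ : IsAlgebraic (diffAdjoin K {a₁}) y) (hy₂ : IsAlgebraic (diffAdjoin K {a₂}) y) :
    IsAlgebraic K y := by
  obtain ⟨hindep, hdisj⟩ := hD.indep_union h₁ h₂ hne
  have h := hindep.closure_inter_eq_inter_closure
  rw [hdisj.inter_eq] at h
  have hy := h.ge (⟨mem_closure_of_isAlgebraic_diffAdjoin hK hirr h₁.1
    (hD.algebraicIndependent h₁ h₂ hne) hy₁, mem_closure_of_isAlgebraic_diffAdjoin hK hirr h₂.1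
    (hD.algebraicIndependent h₂ h₁ hne.symm) hy₂⟩)
  rw [AlgebraicIndependent.matroid_closure_eq, Algebra.adjoin_empty] at hy
  exact Subalgebra.isAlgebraic_of_isAlgebraic_bot hy

theorem diffEval_eq_zero_of_isGenericSolution [CharZero U] (hK : IsDifferentialSubfield K)
    (hirr : E.IsIrreducible) {a c : U} (ha : E.IsSolution a) (hc : E.IsSolution c)
    (haI : AlgebraicIndependent K fun i : Fin E.order => jet a i)
    (hcI : AlgebraicIndependent K fun i : Fin E.order => jet c i) {G : MvPolynomial ℕ K}
    (hG : diffEval a G = 0) : diffEval c G = 0 := by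
  obtain ⟨P, hP, hdeg, hPE⟩ := exists_polynomial (U := U) hirr
  have hPc : jetEval K E.order c P = 0 := (hPE c).trans hc.1
  exact diffEval_eq_zero_of_generic hP hdeg haI ((hPE a).trans ha.1)
    (fun c : K => ⟨⟨_, hK c c.2⟩, rfl⟩) hG hPc (jetEval_derivative_ne_zero hP hdeg hcI hPc)

theorem vanishingIdeal_le [CharZero U] (hK : IsDifferentialSubfield K)
    (hirr : E.IsIrreducible) {a c : U} (ha : E.IsSolution a) (hc : E.IsSolution c)
    (haI : AlgebraicIndependent K fun i : Fin E.order => jet a i)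
    (hcI : AlgebraicIndependent K fun i : Fin E.order => jet c i) :
    vanishingIdeal K ![a] ≤ vanishingIdeal K ![c] := by
  intro G hG
  have hev : ∀ x : U, MvPolynomial.aeval (R := K)
      (fun p : Fin 1 × ℕ => (fun x : U => x′)^[p.2] (![x] p.1)) G =
        diffEval x (MvPolynomial.rename Prod.snd G) := fun x => by
    rw [diffEval, MvPolynomial.aeval_rename]
    congr 2
    ext ⟨i, j⟩
    rw [Subsingleton.elim i 0]
    rfl
  rw [vanishingIdeal, RingHom.mem_ker, hev] at hG ⊢
  exact diffEval_eq_zero_of_isGenericSolution hK hirr ha hc haI hcI hG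

theorem sameType [CharZero U] (hK : IsDifferentialSubfield K)
    (hirr : E.IsIrreducible) {a c : U} (ha : E.IsSolution a) (hc : E.IsSolution c)
    (haI : AlgebraicIndependent K fun i : Fin E.order => jet a i)
    (hcI : AlgebraicIndependent K fun i : Fin E.order => jet c i) : SameType K ![a] ![c] :=
  le_antisymm (vanishingIdeal_le hK hirr ha hc haI hcI) (vanishingIdeal_le hK hirr hc ha hcI haI)

/-- If `a` were outside `K⟨S⟩`, a second generic solution `x` would also have `b` algebraic over
`K⟨x⟩`, which independence forbids for `b ∉ K`. -/
theorem mem_diffAdjoin_of_isAlgebraic [CharZero U] (hclosed : IsDifferentiallyClosed U)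
    (hK : IsDifferentialSubfield K) (hKalg : IsAlgClosed K) (hirr : E.IsIrreducible)
    (hD : E.PropertyD 2) {a : U} (ha : E.IsGenericSolution a) {S : Set U} {b : U} (hbS : b ∈ S)
    (hb : IsAlgebraic (diffAdjoin K {a}) b) (hbK : b ∉ K) : a ∈ diffAdjoin K S := by
  by_contra hmem
  have hmap : ∀ (x : U) (f : MvPolynomial ℕ K),
      diffEval x (MvPolynomial.map (algebraMap K (diffAdjoin K S)) f) = diffEval x f := fun x f =>
    MvPolynomial.aeval_map_algebraMap ..
  obtain ⟨G, h, hG, hh, hGh⟩ := exists_diffEval_of_isAlgebraic hK (subset_diffAdjoin S hbS) hb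
  have hmul : ∀ x : U, diffEval x
      (h * MvPolynomial.map (algebraMap K (diffAdjoin K S)) E.den) =
        diffEval x h * diffEval x E.den := fun x => by
    rw [← hmap x E.den]
    exact map_mul _ _ _
  obtain ⟨x, hxa, hx, hx'⟩ := exists_ne_specialization (k := diffAdjoin K S) hclosed
    (fun c => ⟨⟨_, deriv_mem_diffAdjoin c.2⟩, rfl⟩) (a := a)
    ⟨MvPolynomial.map (algebraMap K (diffAdjoin K S)) E.num,
      (map_ne_zero_iff _ (MvPolynomial.map_injective _ (algebraMap K _).injective)).2 hirr.ne_zero,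
      (hmap a _).trans ha.1.1⟩
    (by
      rintro ⟨y, rfl⟩
      exact hmem y.2)
    (h := h * MvPolynomial.map (algebraMap K (diffAdjoin K S)) E.den)
    (by
      rw [hmul]
      exact mul_ne_zero hh ha.1.2)
  rw [hmul, mul_ne_zero_iff] at hx'
  have hbx := hGh x (hx G hG) hx'.1
  have hxgen : E.IsGenericSolution x := by
    refine ⟨⟨?_, hx'.2⟩, fun hxalg => hbK (mem_of_isAlgebraic_of_isAlgClosed hKalg ?_)⟩
    · rw [← hmap]
      exact hx _ ((hmap a _).trans ha.1.1)
    -- If `x` were algebraic over `K`, then `K⟨x⟩ = K` and `b` itself would be algebraic over `K`.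
    · have hbot : diffAdjoin K {x} = ⊥ := by
        refine bot_unique (sInf_le ⟨fun y hy => ?_, Set.singleton_subset_iff.2 ?_⟩)
        · obtain ⟨c, rfl⟩ := IntermediateField.mem_bot.1 hy
          exact IntermediateField.mem_bot.2 ⟨⟨_, hK c c.2⟩, rfl⟩
        · exact IntermediateField.mem_bot.2
            ⟨⟨x, mem_of_isAlgebraic_of_isAlgClosed hKalg hxalg⟩, rfl⟩
      rw [hbot] at hbx
      exact hbx.restrictScalars K
  exact hbK (mem_of_isAlgebraic_of_isAlgClosed hKalg
    (isAlgebraic_of_isAlgebraic_diffAdjoin hK hirr hD ha hxgen hxa.symm hb hbx))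

theorem isMorleySequence [CharZero U] (hK : IsDifferentialSubfield K) (hKalg : IsAlgClosed K)
    (hirr : E.IsIrreducible) (hD : E.PropertyD 2) {c a a₁ : U} (hc : E.IsGenericSolution c)
    (ha : E.IsGenericSolution a) (ha₁ : E.IsGenericSolution a₁) (hne : a ≠ a₁) :
    IsMorleySequence K ![c] ![![a], ![a₁]] := by
  have haI := hD.algebraicIndependent ha ha₁ hne
  have ha₁I := hD.algebraicIndependent ha₁ ha hne.symm
  have hcI : AlgebraicIndependent K fun i : Fin E.order => jet c i := by
    -- Property D₂ speaks of pairs, so `c` needs a distinct partner: `a` serves unless `c = a`,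
    -- where `a₁` has already been used.
    by_cases h : c = a
    · exact h ▸ haI
    · exact hD.algebraicIndependent hc ha h
  refine ⟨?_, fun i => ?_, fun i hi => ?_⟩
  · have h : algebraicClosure K U = ⊥ := IntermediateField.eq_bot_of_isAlgClosed_of_isAlgebraic _
    have hdisj : ∀ L : IntermediateField K U, L = ⊥ →
        (diffAdjoin K (Set.range ![c])).LinearDisjoint L := by
      rintro _ rfl
      exact IntermediateField.LinearDisjoint.bot_right _
    exact hdisj _ h
  · fin_cases i
    exacts [sameType hK hirr ha.1 hc.1 haI hcI, sameType hK hirr ha₁.1 hc.1 ha₁I hcI]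
  · obtain rfl : i = 1 := Fin.ext (by have := i.2; change (i : ℕ) = 1; omega)
    have h : {x : U | ∃ j : Fin 2, j < 1 ∧ x ∈ Set.range ((![![a], ![a₁]] : Fin 2 → Fin 1 → U) j)} =
        {a} := by
      ext x
      simp
    have h' : Set.range ((![![a], ![a₁]] : Fin 2 → Fin 1 → U) 1) = {a₁} := by simp
    rw [h, h']
    exact algIndependentFields hK hirr hD ha₁ ha hne.symm

end DiffAlgEquation

theorem lemmaL {U : Type*} [Field U] [CharZero U] [Differential U]
    (hclosed : IsDifferentiallyClosed U) (hsat : IsAlephOneSaturated U)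
    (K : Subfield U) (hK : IsDifferentialSubfield K) (hKcount : Countable K)
    (hKalg : IsAlgClosed K)
    (E : DiffAlgEquation K) (hirr : E.IsIrreducible) (hord : 1 ≤ E.order)
    (hD : E.PropertyD 2) :
    (∀ c a a₁ : U, E.IsGenericSolution c → E.IsGenericSolution a → E.IsGenericSolution a₁ →
      a ≠ a₁ → IsMorleySequence K ![c] ![![a], ![a₁]]) ∧
    (∀ a : U, E.IsGenericSolution a → ∀ (m : ℕ) (b : Fin m → U),
      (∀ i, IsAlgebraic (diffAdjoin K {a}) (b i)) →
        (∀ i, b i ∈ K) ∨ a ∈ diffAdjoin K (Set.range b)) := by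
  refine ⟨fun c a a₁ hc ha ha₁ hne =>
    DiffAlgEquation.isMorleySequence hK hKalg hirr hD hc ha ha₁ hne, fun a ha m b hb => ?_⟩
  refine or_iff_not_imp_left.2 fun h => ?_
  obtain ⟨i, hi⟩ := not_forall.1 h
  exact DiffAlgEquation.mem_diffAdjoin_of_isAlgebraic hclosed hK hKalg hirr hD ha ⟨i, rfl⟩ (hb i) hi
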